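/- Coordinates in $\mathbb R^3$ are $(x,y,z)$, with $z$ vertical. A \emph{box} is a non-degenerate closed cuboid with edges parallel to the coordinate axes. An \emph{orthogonal polyhedron} is a connected $3$-manifold with boundary in $\mathbb R^3$ that is a union of finitely many boxes; a \emph{reflex edge} is an edge with interior dihedral angle $270^\circ$. Consider orthogonal polyhedra with no vertical reflex edges. Such a polyhedron has a unique partition into maximal boxes, called \emph{bricks}, any two of which are either disjoint or touch only at the top face of one and the bottom face of the other; a non-empty intersection of two bricks is a \emph{contact rectangle}. A contact rectangle is \emph{primitive} if exactly one of its four sides is a reflex edge, i.e. if the vertical projection of one of the two bricks is a rectangle contained in that of the other, with three of its sides lying on the sides of the latter and the fourth side strictly inside. A \emph{castle} is such a polyhedron in which all contact rectangles are primitive and every brick has either zero or two bricks attached to its top face. A \emph{prism} is the product of a planar region and a segment parallel to a coordinate axis. A \emph{closed} (resp. \emph{open}) \emph{reflex edge guard} is a reflex edge with (resp. without) its two endpoints. A set of guards \emph{guards} $\mathcal C$ if for every $p\in\mathcal C$ there is a point $q$ of some guard such that the segment $pq$ is contained in $\mathcal C$. \textbf{Lemma.} Let $r\ge 0$ be an integer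 and let $\mathcal C$ be a castle with exactly $2r$ reflex edges that is not a prism. Then $\mathcal C$ can be guarded by at most $r$ open reflex edge guards, and also by at most $r$ closed reflex edge guards. -/

import Mathlib

open scoped Topology

namespace OrthoPoly

/-- Points of three-dimensional space; coordinate `2` is the vertical one. Only the affine and
topological structure is used. -/
abbrev Point : Type := Fin 3 → ℝ

/-- A box: a non-degenerate cuboid whose edges are parallel to the coordinate axes. -/
structure Box where
  /-- the corner with the smallest coordinates -/
  lo : Point
  /-- the corner with the largest coordinates -/
  hi : Point
  lt : ∀ i, lo i < hi i

/-- The (closed) set of points of a box. -/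
def Box.carrier (b : Box) : Set Point := {p | ∀ i, b.lo i ≤ p i ∧ p i ≤ b.hi i}

/-- An orthogonal polyhedron: a connected topological 3-manifold with boundary in space that is the
union of finitely many boxes. -/
def IsOrthogonalPolyhedron (P : Set Point) : Prop :=
  IsConnected P ∧
  Nonempty (ChartedSpace (EuclideanHalfSpace 3) P) ∧
  ∃ S : Set Box, S.Finite ∧ P = ⋃ b ∈ S, b.carrier

/-- `p` is a point in the relative interior of a reflex edge of `P` parallel to axis `i`: near `p`,
the set `P` is the complement of an open quarter-space (a right-angled wedge) whose edge is the line
through `p` parallel to axis `i`. Equivalently, the interior dihedral angle at `p` is 270 degrees. -/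
def IsReflexPoint (P : Set Point) (i : Fin 3) (p : Point) : Prop :=
  ∃ s : Fin 3 → ℝ, (∀ j, s j = 1 ∨ s j = -1) ∧
    ∀ᶠ q in 𝓝 p, (q ∈ P ↔ ∃ j, j ≠ i ∧ s j * (q j - p j) ≤ 0)

/-- The reflex edges of `P`. An edge is given by its two endpoints, ordered so that the only
coordinate in which they differ is smaller in the first one; it is a maximal axis-parallel segment
whose relative interior consists of reflex points. -/
def reflexEdges (P : Set Point) : Set (Point × Point) :=
  {e | ∃ i : Fin 3, e.1 i < e.2 i ∧ (∀ j, j ≠ i → e.1 j = e.2 j) ∧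
    (∀ p ∈ openSegment ℝ e.1 e.2, IsReflexPoint P i p) ∧
    ¬ IsReflexPoint P i e.1 ∧ ¬ IsReflexPoint P i e.2}

/-- A 2-reflex orthogonal polyhedron, placed so that all its reflex edges are horizontal. -/
def IsTwoReflex (P : Set Point) : Prop :=
  IsOrthogonalPolyhedron P ∧ ∀ e ∈ reflexEdges P, e.1 2 = e.2 2

/-- `B` is the partition of `P` into bricks: cuboids any two of which are disjoint or touch at a top
and a bottom face only, and which are maximal (no two of them merge into a single cuboid). -/
def IsBrickPartition (P : Set Point) (B : Set Box) : Prop :=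
  B.Finite ∧ P = (⋃ b ∈ B, b.carrier) ∧
  (∀ b ∈ B, ∀ b' ∈ B, b ≠ b' →
    Disjoint b.carrier b'.carrier ∨ b.hi 2 = b'.lo 2 ∨ b'.hi 2 = b.lo 2) ∧
  (∀ b ∈ B, ∀ b' ∈ B, b ≠ b' → ∀ c : Box, c.carrier ≠ b.carrier ∪ b'.carrier)

/-- The box `b'` is attached to the top face of the box `b`: they meet (in their contact rectangle),
and the bottom face of `b'` is at the height of the top face of `b`. -/
def IsAttachedOnTop (b b' : Box) : Prop :=
  b'.lo 2 = b.hi 2 ∧ (b.carrier ∩ b'.carrier).Nonempty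

/-- The vertical projection of `c` is a rectangle inside that of `p` that has three sides on the
sides of the latter, while the fourth side (the one orthogonal to the horizontal axis `i`) is
strictly inside. -/
def IsPrimitiveChild (c p : Box) : Prop :=
  ∃ i : Fin 3, i ≠ 2 ∧
    (∀ j, j ≠ i → j ≠ 2 → c.lo j = p.lo j ∧ c.hi j = p.hi j) ∧
    ((c.lo i = p.lo i ∧ c.hi i < p.hi i) ∨ (p.lo i < c.lo i ∧ c.hi i = p.hi i))

/-- The contact rectangle of two touching bricks, `b` below and `b'` above, is primitive: exactly one
of its four sides is a reflex edge. Either brick may be the larger one. -/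
def IsPrimitiveContact (b b' : Box) : Prop :=
  IsPrimitiveChild b' b ∨ IsPrimitiveChild b b'

/-- `P` is a stack with brick partition `B`: a 2-reflex orthogonal polyhedron all of whose contact
rectangles are primitive. -/
def IsStackWith (P : Set Point) (B : Set Box) : Prop :=
  IsTwoReflex P ∧ IsBrickPartition P B ∧
  ∀ b ∈ B, ∀ b' ∈ B, IsAttachedOnTop b b' → IsPrimitiveContact b b'

/-- A castle: a stack in which every brick has zero or two bricks attached to its top face. -/
def IsCastle (P : Set Point) : Prop :=
  ∃ B : Set Box, IsStackWith P B ∧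
    ∀ b ∈ B, {b' ∈ B | IsAttachedOnTop b b'}.encard = 0 ∨
      {b' ∈ B | IsAttachedOnTop b b'}.encard = 2

/-- An (orthogonal) prism: the product of a planar set `A` and a non-degenerate closed interval
along some coordinate axis `i`. -/
def IsPrism (P : Set Point) : Prop :=
  ∃ (i : Fin 3) (a b : ℝ) (A : Set ({j : Fin 3 // j ≠ i} → ℝ)), a < b ∧
    P = {p | (fun j : {j : Fin 3 // j ≠ i} => p j) ∈ A ∧ a ≤ p i ∧ p i ≤ b}

/-- Two points see each other in `P` if the segment joining them lies in `P`. -/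
def Sees (P : Set Point) (x y : Point) : Prop := segment ℝ x y ⊆ P

/-- Every point of `P` is seen by some point of some guard, for at most `n` guards, each placed on a
reflex edge of `P`; `extent a b` is the set of points of the guard on the edge with endpoints `a`
and `b`. -/
def GuardableByReflexEdges (P : Set Point) (extent : Point → Point → Set Point) (n : ℕ) : Prop :=
  ∃ G : Finset (Point × Point), (∀ e ∈ G, e ∈ reflexEdges P) ∧ G.card ≤ n ∧
    ∀ p ∈ P, ∃ e ∈ G, ∃ x ∈ extent e.1 e.2, Sees P x p

/-- `P` is guardable by at most `n` closed reflex edge guards. -/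
def GuardableByClosed (P : Set Point) (n : ℕ) : Prop :=
  GuardableByReflexEdges P (fun a b => segment ℝ a b) n

/-- `P` is guardable by at most `n` open reflex edge guards (segments without their endpoints). -/
def GuardableByOpen (P : Set Point) (n : ℕ) : Prop :=
  GuardableByReflexEdges P (fun a b => openSegment ℝ a b) n

end OrthoPoly

open OrthoPoly

namespace OrthoPoly

/-! The bricks form a binary tree growing upward from a lowest brick. Two bricks attached to the
same brick sit at its opposite ends along a horizontal axis (a fork), and connectedness leaves no
brick outside the tree. Each fork contributes two reflex edges, the inner sides of its contact
rectangles (its ridges). So there are n ≤ r forks (`exists_reflexEdges`), and n guards are enough.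

A ridge at coordinate t along axis i spans the forked brick along the other axis j. It watches every
brick of the subtree over its contact rectangle whose i-extent contains t, because that brick
together with the column under it is a box reaching down to the ridge (`ridge_watches_of_standsOn`).
Consider a subtree with one guarded side orthogonal to i. At a fork along i, the child at that side
inherits the guard and the other child needs one new guard on its inner side. At a fork along j,
both children inherit it and nothing is added. The subtree thus costs at most one guard per fork,
and fewer if some fork is along j (`exists_guards`).

At the root, forked along i, both ridges receive guards: one too many, which any fork along j
repays. With no such fork all bricks have the same j-extent, and the castle is a prism. -/

theorem Box.carrier_eq_Icc (b : Box) : b.carrier = Set.Icc b.lo b.hi := by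
  ext p
  simp only [Box.carrier, Set.mem_ofPred_eq, Set.mem_Icc, Pi.le_def, forall_and]

theorem Box.isClosed_carrier (b : Box) : IsClosed b.carrier := by
  rw [b.carrier_eq_Icc]; exact isClosed_Icc

theorem Box.lo_mem (b : Box) : b.lo ∈ b.carrier := fun i => ⟨le_rfl, (b.lt i).le⟩

theorem Box.sees (b : Box) {P : Set Point} (hb : b.carrier ⊆ P) {x y : Point}
    (hx : x ∈ b.carrier) (hy : y ∈ b.carrier) : Sees P x y := by
  refine Set.Subset.trans (Convex.segment_subset ?_ hx hy) hb
  rw [b.carrier_eq_Icc]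
  exact convex_Icc _ _

/-! ### Stacked bricks and forks -/

/-- Bricks pairwise disjoint, except at the top of one and the bottom of the other. -/
def IsStacked (B : Set Box) : Prop :=
  ∀ b ∈ B, ∀ b' ∈ B, b ≠ b' →
    Disjoint b.carrier b'.carrier ∨ b.hi 2 = b'.lo 2 ∨ b'.hi 2 = b.lo 2

theorem IsStacked.eq_of_lo_eq {B : Set Box} (hB : IsStacked B) {b c : Box} (hb : b ∈ B)
    (hc : c ∈ B) (h : b.lo 2 = c.lo 2) {p : Point} (hpb : p ∈ b.carrier) (hpc : p ∈ c.carrier) :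
    b = c := by
  by_contra hne
  have h1 := b.lt 2
  have h2 := c.lt 2
  rcases hB b hb c hc hne with h' | h' | h'
  · exact Set.disjoint_left.1 h' hpb hpc
  · linarith
  · linarith

theorem IsStacked.eq_of_hi_eq {B : Set Box} (hB : IsStacked B) {b c : Box} (hb : b ∈ B)
    (hc : c ∈ B) (h : b.hi 2 = c.hi 2) {p : Point} (hpb : p ∈ b.carrier) (hpc : p ∈ c.carrier) :
    b = c := by
  by_contra hne
  have h1 := b.lt 2
  have h2 := c.lt 2
  rcases hB b hb c hc hne with h' | h' | h'
  · exact Set.disjoint_left.1 h' hpb hpc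
  · linarith
  · linarith

/-- The bricks attached on top of `v` are `a` and `b`, at the two ends of `v` along the horizontal
axis `i`, both as wide as `v` along the other horizontal axis `j`. -/
structure IsFork (B : Set Box) (v a b : Box) (i j : Fin 3) : Prop where
  mem : v ∈ B
  mem_left : a ∈ B
  mem_right : b ∈ B
  ne : i ≠ j
  ne_fst : i ≠ 2
  ne_snd : j ≠ 2
  left_bot : a.lo 2 = v.hi 2
  right_bot : b.lo 2 = v.hi 2
  left_lo : a.lo i = v.lo i
  gap : a.hi i < b.lo i
  right_hi : b.hi i = v.hi i
  left_lo' : a.lo j = v.lo j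
  left_hi' : a.hi j = v.hi j
  right_lo' : b.lo j = v.lo j
  right_hi' : b.hi j = v.hi j
  attached : ∀ u ∈ B, IsAttachedOnTop v u ↔ u = a ∨ u = b

theorem axis_cases {i j : Fin 3} (hij : i ≠ j) (hi : i ≠ 2) (hj : j ≠ 2) (k : Fin 3) :
    k = i ∨ k = j ∨ k = 2 := by
  omega

theorem forall_axis {i j : Fin 3} (hij : i ≠ j) (hi : i ≠ 2) (hj : j ≠ 2) {Q : Fin 3 → Prop} :
    (∀ k, Q k) ↔ Q i ∧ Q j ∧ Q 2 := by
  refine ⟨fun h => ⟨h i, h j, h 2⟩, fun h k => ?_⟩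
  rcases axis_cases hij hi hj k with rfl | rfl | rfl
  exacts [h.1, h.2.1, h.2.2]

/-- The point with the given coordinates along `i`, along the vertical axis, and elsewhere. -/
def mkPoint (i : Fin 3) (x y z : ℝ) : Point :=
  fun k => if k = i then x else if k = 2 then z else y

theorem mkPoint_fst (i : Fin 3) (x y z : ℝ) : mkPoint i x y z i = x := by simp [mkPoint]

theorem mkPoint_snd {i j : Fin 3} (hij : i ≠ j) (hj : j ≠ 2) (x y z : ℝ) :
    mkPoint i x y z j = y := by simp [mkPoint, hij.symm, hj]

theorem mkPoint_two {i : Fin 3} (hi : i ≠ 2) (x y z : ℝ) : mkPoint i x y z 2 = z := by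
  simp [mkPoint, hi.symm]

/-- If `v` were the smaller brick, `a` would cover its whole top face and hence meet `b` at the same
bottom level. -/
theorem primitive_child_of_attached {B : Set Box} (hB : IsStacked B) {v a b : Box}
    (ha : a ∈ B) (hb : b ∈ B) (hab : a ≠ b) (hva : IsAttachedOnTop v a)
    (hvb : IsAttachedOnTop v b) (h : IsPrimitiveContact v a) : IsPrimitiveChild a v := by
  refine h.resolve_right ?_
  rintro ⟨i, hi, hj, hs⟩
  obtain ⟨h2, p, hpv, hpb⟩ := hvb
  refine hab (hB.eq_of_lo_eq ha hb (hva.1.trans h2.symm) (p := p) ?_ hpb)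
  intro k
  have hk := hpv k
  by_cases hk2 : k = 2
  · subst hk2
    have := (hpb 2).1
    have := a.lt 2
    have := hva.1
    constructor <;> linarith
  by_cases hki : k = i
  · subst hki
    rcases hs with hs | hs <;> constructor <;> linarith
  · have := hj k hki hk2
    constructor <;> linarith

theorem exists_isFork {B : Set Box} (hB : IsStacked B) {v : Box} (hv : v ∈ B)
    (hp : ∀ b' ∈ B, IsAttachedOnTop v b' → IsPrimitiveContact v b')
    (h2 : {b' ∈ B | IsAttachedOnTop v b'}.encard = 2) :
    ∃ a b i j, IsFork B v a b i j := by
  obtain ⟨a, b, hab, hS⟩ := Set.encard_eq_two.1 h2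
  have hatt : ∀ u ∈ B, IsAttachedOnTop v u ↔ u = a ∨ u = b := by
    intro u hu
    have : u ∈ {b' ∈ B | IsAttachedOnTop v b'} ↔ u ∈ ({a, b} : Set Box) := by rw [hS]
    simpa [hu] using this
  have ha : a ∈ B ∧ IsAttachedOnTop v a := by
    have : a ∈ {b' ∈ B | IsAttachedOnTop v b'} := by rw [hS]; simp
    exact this
  have hb : b ∈ B ∧ IsAttachedOnTop v b := by
    have : b ∈ {b' ∈ B | IsAttachedOnTop v b'} := by rw [hS]; simp
    exact this
  obtain ⟨ha, hva⟩ := ha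
  obtain ⟨hb, hvb⟩ := hb
  have hza := hva.1
  have hzb := hvb.1
  have hdisj : ∀ p : Point, p ∈ a.carrier → p ∈ b.carrier → False := fun p h h' =>
    hab (hB.eq_of_lo_eq ha hb (hza.trans hzb.symm) h h')
  obtain ⟨i, hi, hja, hia⟩ := primitive_child_of_attached hB ha hb hab hva hvb (hp a ha hva)
  obtain ⟨i', hi', hjb, hib⟩ :=
    primitive_child_of_attached hB hb ha hab.symm hvb hva (hp b hb hvb)
  have hla := a.lt
  have hlb := b.lt
  have hlv := v.lt
  -- With different axes, each brick has the full extent of `v` along the axis on which the other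
  -- shrinks, so a corner point would lie in both.
  obtain rfl : i = i' := by
    by_contra hne
    have h1 := hja i' (Ne.symm hne) hi'
    have h2 := hjb i hne hi
    refine hdisj (mkPoint i (a.lo i) (b.lo i') (v.hi 2)) ?_ ?_
    all_goals
      refine (forall_axis hne hi hi').2 ⟨?_, ?_, ?_⟩
      · rw [mkPoint_fst]
        have := hla i; have := hlv i
        rcases hia with hia | hia <;> constructor <;> linarith
      · rw [mkPoint_snd hne hi']
        have := hlb i'; have := hlv i'
        rcases hib with hib | hib <;> constructor <;> linarith
      · rw [mkPoint_two hi]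
        have := hla 2; have := hlb 2
        constructor <;> linarith
  obtain ⟨j, hij, hj⟩ : ∃ j : Fin 3, i ≠ j ∧ j ≠ 2 := by
    have : ∀ i : Fin 3, i ≠ 2 → ∃ j : Fin 3, i ≠ j ∧ j ≠ 2 := by decide
    exact this i hi
  have h1 := hja j hij.symm hj
  have h2 := hjb j hij.symm hj
  -- Both bricks span `v` along `j`, so their `i`-extents must be disjoint. This excludes two bricks
  -- at the same end and makes the gap between opposite ends strict.
  have key : ∀ x, a.lo i ≤ x → x ≤ a.hi i → b.lo i ≤ x → x ≤ b.hi i → False := by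
    intro x hx1 hx2 hx3 hx4
    refine hdisj (mkPoint i x (v.lo j) (v.hi 2)) ?_ ?_
    all_goals
      refine (forall_axis hij hi hj).2 ⟨?_, ?_, ?_⟩
      · rw [mkPoint_fst]
        constructor <;> assumption
      · rw [mkPoint_snd hij hj]
        have := hlv j
        constructor <;> linarith
      · rw [mkPoint_two hi]
        have := hla 2; have := hlb 2
        constructor <;> linarith
  have hai := hla i
  have hbi := hlb i
  rcases hia with hia | hia <;> rcases hib with hib | hib
  · exact (key (v.lo i) (by linarith) (by linarith) (by linarith) (by linarith)).elim
  · refine ⟨a, b, i, j, hv, ha, hb, hij, hi, hj, hza, hzb, hia.1, ?_, hib.2, h1.1, h1.2, h2.1,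
      h2.2, hatt⟩
    by_contra! hle
    exact key (b.lo i) (by linarith) (by linarith) (by linarith) (by linarith)
  · refine ⟨b, a, i, j, hv, hb, ha, hij, hi, hj, hzb, hza, hib.1, ?_, hia.2, h2.1, h2.2, h1.1,
      h1.2, fun u hu => (hatt u hu).trans or_comm⟩
    by_contra! hle
    exact key (a.lo i) (by linarith) (by linarith) (by linarith) (by linarith)
  · exact (key (v.hi i) (by linarith) (by linarith) (by linarith) (by linarith)).elim

/-! ### Columns and visibility from ridges -/

/-- `w` stands on `c`: its projection is inside that of `c`, and the column below it down to the
level of the bottom of `c` is inside `P`. -/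
def StandsOn (P : Set Point) (c w : Box) : Prop :=
  (∀ k, k ≠ 2 → c.lo k ≤ w.lo k ∧ w.hi k ≤ c.hi k) ∧ c.lo 2 ≤ w.lo 2 ∧
    ∀ p : Point, (∀ k, k ≠ 2 → w.lo k ≤ p k ∧ p k ≤ w.hi k) → c.lo 2 ≤ p 2 → p 2 ≤ w.hi 2 → p ∈ P

theorem StandsOn.refl {P : Set Point} {c : Box} (hc : c.carrier ⊆ P) : StandsOn P c c := by
  refine ⟨fun k _ => ⟨le_rfl, le_rfl⟩, le_rfl, fun p hp h1 h2 => hc fun k => ?_⟩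
  by_cases hk : k = 2
  · subst hk; exact ⟨h1, h2⟩
  · exact hp k hk

theorem StandsOn.step {P : Set Point} {v c w : Box} (hv : v.carrier ⊆ P)
    (hcv : ∀ k, k ≠ 2 → v.lo k ≤ c.lo k ∧ c.hi k ≤ v.hi k) (hz : c.lo 2 = v.hi 2)
    (h : StandsOn P c w) : StandsOn P v w := by
  obtain ⟨h1, h2, h3⟩ := h
  have hvz := v.lt 2
  refine ⟨fun k hk => ⟨(hcv k hk).1.trans (h1 k hk).1, (h1 k hk).2.trans (hcv k hk).2⟩,
    by linarith, fun p hp hp1 hp2 => ?_⟩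
  rcases le_total (c.lo 2) (p 2) with hle | hle
  · exact h3 p hp hle hp2
  · refine hv fun k => ?_
    by_cases hk : k = 2
    · subst hk; exact ⟨hp1, by linarith⟩
    · have := hp k hk
      have := h1 k hk
      have := hcv k hk
      constructor <;> linarith

theorem IsFork.left_subset {B : Set Box} {v a b : Box} {i j : Fin 3} (h : IsFork B v a b i j)
    (k : Fin 3) (hk : k ≠ 2) : v.lo k ≤ a.lo k ∧ a.hi k ≤ v.hi k := by
  rcases axis_cases h.ne h.ne_fst h.ne_snd k with rfl | rfl | rfl
  · have := h.gap; have := b.lt k; have := h.right_hi; have := h.left_lo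
    constructor <;> linarith
  · exact ⟨h.left_lo'.ge, h.left_hi'.le⟩
  · exact (hk rfl).elim

theorem IsFork.right_subset {B : Set Box} {v a b : Box} {i j : Fin 3} (h : IsFork B v a b i j)
    (k : Fin 3) (hk : k ≠ 2) : v.lo k ≤ b.lo k ∧ b.hi k ≤ v.hi k := by
  rcases axis_cases h.ne h.ne_fst h.ne_snd k with rfl | rfl | rfl
  · have := h.gap; have := a.lt k; have := h.right_hi; have := h.left_lo
    constructor <;> linarith
  · exact ⟨h.right_lo'.ge, h.right_hi'.le⟩
  · exact (hk rfl).elim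

/-- The segment at height `v.hi 2` spanning `v` along `j`, with coordinate `t` along `i`. -/
def ridge (v : Box) (i j : Fin 3) (t : ℝ) : Point × Point :=
  (mkPoint i t (v.lo j) (v.hi 2), mkPoint i t (v.hi j) (v.hi 2))

theorem mem_openSegment_mkPoint {i j : Fin 3} (hij : i ≠ j) (hi : i ≠ 2) (hj : j ≠ 2)
    {t l u z : ℝ} (hlu : l < u) {p : Point} :
    p ∈ openSegment ℝ (mkPoint i t l z) (mkPoint i t u z) ↔
      p i = t ∧ (l < p j ∧ p j < u) ∧ p 2 = z := by
  constructor
  · rintro ⟨α, β, hα, hβ, hαβ, rfl⟩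
    obtain rfl : β = 1 - α := by linarith
    simp only [Pi.add_apply, Pi.smul_apply, smul_eq_mul, mkPoint_fst, mkPoint_snd hij hj,
      mkPoint_two hi]
    refine ⟨by ring, ⟨?_, ?_⟩, by ring⟩ <;> nlinarith
  · rintro ⟨h1, ⟨h2, h3⟩, h4⟩
    have hd : 0 < u - l := by linarith
    refine ⟨(u - p j) / (u - l), (p j - l) / (u - l), div_pos (by linarith) hd,
      div_pos (by linarith) hd, by field_simp; ring, ?_⟩
    funext k
    revert k
    rw [forall_axis hij hi hj]
    simp only [Pi.add_apply, Pi.smul_apply, smul_eq_mul, mkPoint_fst, mkPoint_snd hij hj,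
      mkPoint_two hi, h1, h4]
    refine ⟨?_, ?_, ?_⟩ <;> field_simp <;> ring

/-- Every point of `w` is seen from some relative interior point of the edge `e`. -/
def Watches (P : Set Point) (e : Point × Point) (w : Box) : Prop :=
  ∀ p ∈ w.carrier, ∃ x ∈ openSegment ℝ e.1 e.2, Sees P x p

theorem ridge_watches_base {P : Set Point} {v : Box} {i j : Fin 3} (hij : i ≠ j) (hi : i ≠ 2)
    (hj : j ≠ 2) {t : ℝ} (ht : v.lo i ≤ t ∧ t ≤ v.hi i) (hv : v.carrier ⊆ P) :
    Watches P (ridge v i j t) v := by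
  intro p hp
  have hlt := v.lt
  refine ⟨mkPoint i t ((v.lo j + v.hi j) / 2) (v.hi 2), ?_, v.sees hv ?_ hp⟩
  · refine (mem_openSegment_mkPoint hij hi hj (hlt j)).2 ?_
    rw [mkPoint_fst, mkPoint_snd hij hj, mkPoint_two hi]
    have := hlt j
    exact ⟨rfl, ⟨by linarith, by linarith⟩, rfl⟩
  · refine (forall_axis hij hi hj).2 ?_
    rw [mkPoint_fst, mkPoint_snd hij hj, mkPoint_two hi]
    have := hlt j
    exact ⟨ht, ⟨by linarith, by linarith⟩, (hlt 2).le, le_rfl⟩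

/-- The brick `w` and its column down to the ridge level form a convex box in `P`. The midpoint of
the `j`-extent of `w` gives a point of this box in the relative interior of the ridge, so open
guards suffice. -/
theorem ridge_watches_of_standsOn {P : Set Point} {v c w : Box} {i j : Fin 3} (hij : i ≠ j)
    (hi : i ≠ 2) (hj : j ≠ 2) {t : ℝ} (ht : w.lo i ≤ t ∧ t ≤ w.hi i) (hz : c.lo 2 = v.hi 2)
    (hl : c.lo j = v.lo j) (hh : c.hi j = v.hi j) (h : StandsOn P c w) :
    Watches P (ridge v i j t) w := by
  intro p hp
  obtain ⟨h1, h2, h3⟩ := h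
  have hlt := w.lt
  have h1j := h1 j hj
  have hj' := hlt j
  refine ⟨mkPoint i t ((w.lo j + w.hi j) / 2) (v.hi 2), ?_, ?_⟩
  · refine (mem_openSegment_mkPoint hij hi hj (v.lt j)).2 ?_
    rw [mkPoint_fst, mkPoint_snd hij hj, mkPoint_two hi]
    exact ⟨rfl, ⟨by linarith, by linarith⟩, rfl⟩
  · refine Set.Subset.trans (Convex.segment_subset
      (convex_Icc (mkPoint i (w.lo i) (w.lo j) (c.lo 2)) w.hi) ?_ ?_) ?_
    · rw [Set.mem_Icc, Pi.le_def, Pi.le_def, forall_axis hij hi hj, forall_axis hij hi hj]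
      simp only [mkPoint_fst, mkPoint_snd hij hj, mkPoint_two hi]
      have := hlt 2
      exact ⟨⟨ht.1, by linarith, by linarith⟩, ht.2, by linarith, by linarith⟩
    · rw [Set.mem_Icc, Pi.le_def, Pi.le_def, forall_axis hij hi hj, forall_axis hij hi hj]
      simp only [mkPoint_fst, mkPoint_snd hij hj, mkPoint_two hi]
      have := hp 2
      exact ⟨⟨(hp i).1, (hp j).1, by linarith⟩, (hp i).2, (hp j).2, (hp 2).2⟩
    · rintro q ⟨hq1, hq2⟩
      rw [Pi.le_def, forall_axis hij hi hj] at hq1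
      simp only [mkPoint_fst, mkPoint_snd hij hj, mkPoint_two hi] at hq1
      refine h3 q (fun k hk => ⟨?_, hq2 k⟩) hq1.2.2 (hq2 2)
      rcases axis_cases hij hi hj k with rfl | rfl | rfl
      exacts [hq1.1, hq1.2.1, (hk rfl).elim]

/-! ### Ridges are reflex edges -/

/-- Near a point, a finite union of boxes is the union of those that contain the point. -/
theorem eventually_mem_iff {B : Set Box} (hfin : B.Finite) (p : Point) :
    ∀ᶠ q in 𝓝 p, (q ∈ ⋃ b ∈ B, b.carrier) ↔ ∃ b ∈ B, p ∈ b.carrier ∧ q ∈ b.carrier := by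
  have h : ∀ᶠ q in 𝓝 p, ∀ b ∈ B, p ∉ b.carrier → q ∉ b.carrier := by
    rw [Set.Finite.eventually_all hfin]
    intro b _
    by_cases hp : p ∈ b.carrier
    · simp [hp]
    · filter_upwards [b.isClosed_carrier.isOpen_compl.mem_nhds hp] with q hq _ using hq
  filter_upwards [h] with q hq
  simp only [Set.mem_iUnion, exists_prop]
  constructor
  · rintro ⟨b, hb, hqb⟩
    exact ⟨b, hb, by_contra fun hn => hq b hb hn hqb, hqb⟩
  · rintro ⟨b, hb, _, hqb⟩
    exact ⟨b, hb, hqb⟩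

/-- Near the ridge only `v` and `c` matter, and together they omit exactly a quarter-space. At its
ends both bricks stop along `j`, whereas the local model of a reflex point is invariant along `j`.
-/
theorem ridge_mem_reflexEdges {B : Set Box} (hfin : B.Finite) {v c : Box} (hv : v ∈ B)
    (hc : c ∈ B) {i j : Fin 3} (hij : i ≠ j) (hi : i ≠ 2) (hj : j ≠ 2) {t : ℝ}
    (ht : v.lo i < t ∧ t < v.hi i) (hz : c.lo 2 = v.hi 2) (hl : c.lo j = v.lo j)
    (hh : c.hi j = v.hi j)
    (hs : (c.lo i = v.lo i ∧ c.hi i = t) ∨ (c.lo i = t ∧ c.hi i = v.hi i))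
    (hloc : ∀ u ∈ B, ∀ p : Point, p ∈ v.carrier → p ∈ c.carrier → p ∈ u.carrier → u = v ∨ u = c) :
    ridge v i j t ∈ reflexEdges (⋃ b ∈ B, b.carrier) := by
  have hvj := v.lt j
  have hv2 := v.lt 2
  have hc2 := c.lt 2
  have hci := c.lt i
  have hlocal : ∀ p : Point, p i = t → v.lo j ≤ p j → p j ≤ v.hi j → p 2 = v.hi 2 →
      ∀ᶠ q in 𝓝 p, (q ∈ ⋃ b ∈ B, b.carrier) ↔ q ∈ v.carrier ∨ q ∈ c.carrier := by
    intro p h1 h2 h3 h4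
    have hpv : p ∈ v.carrier := (forall_axis hij hi hj).2
      ⟨⟨by linarith, by linarith⟩, ⟨h2, h3⟩, ⟨by linarith, by linarith⟩⟩
    have hpc : p ∈ c.carrier := (forall_axis hij hi hj).2
      ⟨by rcases hs with hs | hs <;> constructor <;> linarith,
        ⟨by linarith, by linarith⟩, ⟨by linarith, by linarith⟩⟩
    filter_upwards [eventually_mem_iff hfin p] with q hq
    rw [hq]
    constructor
    · rintro ⟨u, hu, hpu, hqu⟩
      rcases hloc u hu p hpv hpc hpu with rfl | rfl
      exacts [Or.inl hqu, Or.inr hqu]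
    · rintro (h | h)
      exacts [⟨v, hv, hpv, h⟩, ⟨c, hc, hpc, h⟩]
  have hcont : ∀ k : Fin 3, Continuous fun q : Point => q k := fun k => continuous_apply k
  have hlt : ∀ (k : Fin 3) (p : Point) (x : ℝ), p k < x → ∀ᶠ q in 𝓝 p, q k < x :=
    fun k p x h => (hcont k).continuousAt.eventually_lt continuousAt_const h
  have hgt : ∀ (k : Fin 3) (p : Point) (x : ℝ), x < p k → ∀ᶠ q in 𝓝 p, x < q k :=
    fun k p x h => continuousAt_const.eventually_lt (hcont k).continuousAt h
  have hend : ∀ p : Point, p i = t → (p j = v.lo j ∨ p j = v.hi j) → p 2 = v.hi 2 →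
      ¬ IsReflexPoint (⋃ b ∈ B, b.carrier) j p := by
    rintro p h1 h2 h3 ⟨s, -, hs'⟩
    have hev := (hlocal p h1 (by rcases h2 with h | h <;> linarith)
      (by rcases h2 with h | h <;> linarith) h3).and hs'
    obtain ⟨ε, hε, hball⟩ := Metric.eventually_nhds_iff.1 hev
    have hmove : ∀ δ : ℝ, |δ| < ε → v.lo j ≤ p j + δ ∧ p j + δ ≤ v.hi j := by
      intro δ hδ
      have hq : dist (Function.update p j (p j + δ)) p < ε := by
        refine (dist_pi_lt_iff hε).2 fun k => ?_
        by_cases hk : k = j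
        · subst hk; simpa [Real.dist_eq] using hδ
        · simpa [hk] using hε
      obtain ⟨hA, hB'⟩ := hball hq
      -- The shift along `j` leaves coordinate `i` unchanged, so the reflex model keeps the shifted
      -- point in the union.
      have hmem := hA.1 (hB'.2 ⟨i, hij, by simp [hij]⟩)
      have hself : Function.update p j (p j + δ) j = p j + δ := by simp
      rcases hmem with h | h
      · simpa [hself] using h j
      · have := h j
        rw [hself] at this
        constructor <;> linarith
    have h4 := hmove (-(ε / 2)) (by rw [abs_neg, abs_of_pos] <;> linarith)
    have h5 := hmove (ε / 2) (by rw [abs_of_pos] <;> linarith)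
    rcases h2 with h2 | h2 <;> linarith [h4.1, h5.2]
  refine ⟨j, ?_, ?_, ?_, ?_, ?_⟩
  · simpa [ridge, mkPoint_snd hij hj] using hvj
  · intro k hk
    rcases axis_cases hij hi hj k with rfl | rfl | rfl
    · simp [ridge, mkPoint_fst]
    · exact (hk rfl).elim
    · simp [ridge, mkPoint_two hi]
  · intro p hp
    obtain ⟨h1, ⟨h2, h3⟩, h4⟩ := (mem_openSegment_mkPoint hij hi hj hvj).1 hp
    have hev := hlocal p h1 h2.le h3.le h4
    have e1 := hlt i p (v.hi i) (by linarith)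
    have e2 := hgt i p (v.lo i) (by linarith)
    have e3 := hlt j p _ h3
    have e4 := hgt j p _ h2
    have e5 := hlt 2 p (c.hi 2) (by linarith)
    have e6 := hgt 2 p (v.lo 2) (by linarith)
    -- The missing quarter lies above `v` and on the side of `t` away from `c`, so the sign along
    -- `i` flips when `c` is on the high side.
    refine ⟨fun k => if k = i ∧ c.lo i = t then -1 else 1, ?_, ?_⟩
    · intro k
      by_cases hk : k = i ∧ c.lo i = t <;> simp [hk]
    filter_upwards [hev, e1, e2, e3, e4, e5, e6] with q hq q1 q2 q3 q4 q5 q6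
    rw [hq]
    have hex : ∀ Q : Fin 3 → Prop, (∃ k, k ≠ j ∧ Q k) ↔ Q i ∨ Q 2 := by
      intro Q
      constructor
      · rintro ⟨k, hk, hQ⟩
        rcases axis_cases hij hi hj k with rfl | rfl | rfl
        exacts [Or.inl hQ, (hk rfl).elim, Or.inr hQ]
      · rintro (h | h)
        exacts [⟨i, hij, h⟩, ⟨2, hj.symm, h⟩]
    have hmem : ∀ b : Box, q ∈ b.carrier ↔ (b.lo i ≤ q i ∧ q i ≤ b.hi i) ∧
        (b.lo j ≤ q j ∧ q j ≤ b.hi j) ∧ b.lo 2 ≤ q 2 ∧ q 2 ≤ b.hi 2 :=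
      fun b => forall_axis hij hi hj
    rw [hex, hmem, hmem]
    simp only [hi.symm, false_and, if_false, true_and, one_mul, h1, h4]
    rcases hs with ⟨hs1, hs2⟩ | ⟨hs1, hs2⟩
    · have hne : c.lo i ≠ t := (hs1.trans_lt ht.1).ne
      simp only [hne, if_false, one_mul]
      constructor
      · rintro (h | h)
        · right; linarith [h.2.2.2]
        · left; linarith [h.1.2]
      · intro h
        rcases le_or_gt (q 2) (v.hi 2) with hle | hgt'
        · left; exact ⟨⟨q2.le, q1.le⟩, ⟨q4.le, q3.le⟩, q6.le, hle⟩
        · right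
          rcases h with h | h
          · exact ⟨⟨by linarith, by linarith⟩, ⟨by linarith, by linarith⟩, by linarith, q5.le⟩
          · linarith
    · simp only [hs1, if_true]
      constructor
      · rintro (h | h)
        · right; linarith [h.2.2.2]
        · left; linarith [h.1.1]
      · intro h
        rcases le_or_gt (q 2) (v.hi 2) with hle | hgt'
        · left; exact ⟨⟨q2.le, q1.le⟩, ⟨q4.le, q3.le⟩, q6.le, hle⟩
        · right
          rcases h with h | h
          · exact ⟨⟨by linarith, by linarith⟩, ⟨by linarith, by linarith⟩, by linarith, q5.le⟩
          · linarith
  · refine hend _ ?_ (Or.inl ?_) ?_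
    · simp [ridge, mkPoint_fst]
    · simp [ridge, mkPoint_snd hij hj]
    · simp [ridge, mkPoint_two hi]
  · refine hend _ ?_ (Or.inr ?_) ?_
    · simp [ridge, mkPoint_fst]
    · simp [ridge, mkPoint_snd hij hj]
    · simp [ridge, mkPoint_two hi]

theorem IsFork.local_bricks {B : Set Box} (hB : IsStacked B) {v a b c : Box} {i j : Fin 3}
    (h : IsFork B v a b i j) (hc : c = a ∨ c = b) (u : Box) (hu : u ∈ B) (p : Point)
    (hpv : p ∈ v.carrier) (hpc : p ∈ c.carrier) (hpu : p ∈ u.carrier) : u = v ∨ u = c := by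
  have hcB : c ∈ B := by rcases hc with rfl | rfl; exacts [h.mem_left, h.mem_right]
  have hz : c.lo 2 = v.hi 2 := by rcases hc with rfl | rfl; exacts [h.left_bot, h.right_bot]
  by_cases huv : u = v
  · exact Or.inl huv
  right
  have h1 := (hpc 2).1
  have h2 := (hpu 2).2
  have h3 := v.lt 2
  rcases hB u hu v h.mem huv with h' | h' | h'
  · exact (Set.disjoint_left.1 h' hpu hpv).elim
  · linarith
  · exact hB.eq_of_lo_eq hu hcB (by linarith) hpu hpc

theorem IsFork.left_reflex {B : Set Box} (hB : IsStacked B) (hfin : B.Finite) {v a b : Box}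
    {i j : Fin 3} (h : IsFork B v a b i j) :
    ridge v i j (a.hi i) ∈ reflexEdges (⋃ b ∈ B, b.carrier) := by
  have h1 := a.lt i
  have h2 := b.lt i
  have h3 := h.gap
  refine ridge_mem_reflexEdges hfin h.mem h.mem_left h.ne h.ne_fst h.ne_snd
    ⟨by linarith [h.left_lo], by linarith [h.right_hi]⟩ h.left_bot h.left_lo' h.left_hi'
    (Or.inl ⟨h.left_lo, rfl⟩) (h.local_bricks hB (Or.inl rfl))

theorem IsFork.right_reflex {B : Set Box} (hB : IsStacked B) (hfin : B.Finite) {v a b : Box}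
    {i j : Fin 3} (h : IsFork B v a b i j) :
    ridge v i j (b.lo i) ∈ reflexEdges (⋃ b ∈ B, b.carrier) := by
  have h1 := a.lt i
  have h2 := b.lt i
  have h3 := h.gap
  refine ridge_mem_reflexEdges hfin h.mem h.mem_right h.ne h.ne_fst h.ne_snd
    ⟨by linarith [h.left_lo], by linarith [h.right_hi]⟩ h.right_bot h.right_lo' h.right_hi'
    (Or.inr ⟨rfl, h.right_hi⟩) (h.local_bricks hB (Or.inr rfl))

/-! ### The binary tree of bricks -/

/-- A brick is attached to the top face of at most one brick. -/
theorem IsFork.eq_of_attached {B : Set Box} (hB : IsStacked B)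
    (hf : ∀ v ∈ B, (∀ u ∈ B, ¬ IsAttachedOnTop v u) ∨ ∃ a b i j, IsFork B v a b i j)
    {u u' w a b : Box} {i j : Fin 3} (h : IsFork B u a b i j) (hw : w = a ∨ w = b)
    (hu' : u' ∈ B) (hatt : IsAttachedOnTop u' w) : u' = u := by
  have key : ∀ {u a b : Box} {i j : Fin 3}, IsFork B u a b i j → w = a ∨ w = b →
      w ∈ B ∧ w.lo ∈ u.carrier ∧ w.lo 2 = u.hi 2 := by
    intro u a b i j h hw
    have hz : w.lo 2 = u.hi 2 := by rcases hw with rfl | rfl; exacts [h.left_bot, h.right_bot]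
    refine ⟨by rcases hw with rfl | rfl; exacts [h.mem_left, h.mem_right], fun k => ?_, hz⟩
    by_cases hk : k = 2
    · subst hk
      have := u.lt 2
      constructor <;> linarith
    · have : u.lo k ≤ w.lo k ∧ w.hi k ≤ u.hi k := by
        rcases hw with rfl | rfl
        exacts [h.left_subset k hk, h.right_subset k hk]
      have := w.lt k
      constructor <;> linarith
  obtain ⟨hwB, h1, h2⟩ := key h hw
  rcases hf u' hu' with h' | ⟨a', b', i', j', h'⟩
  · exact (h' w hwB hatt).elim
  · obtain ⟨-, h3, h4⟩ := key h' ((h'.attached w hwB).1 hatt)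
    exact hB.eq_of_hi_eq hu' h.mem (h4.symm.trans h2) h3 h1

/-- `IsTower B v D n`: the bricks above `v` form a binary tree, `D` is the set of those different
from `v`, and `n` is the number of forks. -/
inductive IsTower (B : Set Box) : Box → Set Box → ℕ → Prop
  | leaf {v : Box} (hv : v ∈ B) (hn : ∀ u ∈ B, ¬ IsAttachedOnTop v u) : IsTower B v ∅ 0
  | fork {v a b : Box} {i j : Fin 3} {D E : Set Box} {m n : ℕ} (h : IsFork B v a b i j)
      (ha : IsTower B a D m) (hb : IsTower B b E n) :
      IsTower B v (insert a D ∪ insert b E) (m + n + 1)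

/-- Recursion on the number of bricks with a higher bottom: a child is counted for its parent but
not for itself. -/
theorem exists_isTower {B : Set Box} (hfin : B.Finite)
    (hf : ∀ v ∈ B, (∀ u ∈ B, ¬ IsAttachedOnTop v u) ∨ ∃ a b i j, IsFork B v a b i j)
    (v : Box) (hv : v ∈ B) : ∃ D n, IsTower B v D n := by
  induction hN : {w ∈ B | v.lo 2 < w.lo 2}.ncard using Nat.strong_induction_on generalizing v with
  | _ N ih =>
    subst hN
    have hlt : ∀ c ∈ B, c.lo 2 = v.hi 2 →
        {w ∈ B | c.lo 2 < w.lo 2}.ncard < {w ∈ B | v.lo 2 < w.lo 2}.ncard := by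
      intro c hc hz
      have := v.lt 2
      refine Set.ncard_lt_ncard ⟨fun w hw => ⟨hw.1, by linarith [hw.2]⟩, fun hsub => ?_⟩
        (hfin.subset fun w hw => hw.1)
      exact lt_irrefl _ (hsub ⟨hc, by linarith⟩ : c ∈ {w ∈ B | c.lo 2 < w.lo 2}).2
    rcases hf v hv with h | ⟨a, b, i, j, h⟩
    · exact ⟨_, _, .leaf hv h⟩
    · obtain ⟨D, m, hD⟩ := ih _ (hlt a h.mem_left h.left_bot) a h.mem_left rfl
      obtain ⟨E, n, hE⟩ := ih _ (hlt b h.mem_right h.right_bot) b h.mem_right rfl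
      exact ⟨_, _, .fork h hD hE⟩

namespace IsTower

variable {B : Set Box} {v : Box} {D : Set Box} {n : ℕ}

theorem mem (h : IsTower B v D n) : v ∈ B := by
  cases h with
  | leaf hv _ => exact hv
  | fork h _ _ => exact h.mem

theorem subset (h : IsTower B v D n) : D ⊆ B := by
  induction h with
  | leaf => exact Set.empty_subset _
  | fork h _ _ iha ihb =>
    exact Set.union_subset (Set.insert_subset h.mem_left iha) (Set.insert_subset h.mem_right ihb)

theorem standsOn {P : Set Point} (hP : ∀ b ∈ B, b.carrier ⊆ P) (h : IsTower B v D n) :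
    ∀ w ∈ insert v D, StandsOn P v w := by
  induction h with
  | leaf hv _ =>
    rintro w (rfl | hw)
    exacts [StandsOn.refl (hP _ hv), hw.elim]
  | fork h _ _ iha ihb =>
    rintro w (rfl | hw | hw)
    · exact StandsOn.refl (hP _ h.mem)
    · exact (iha w hw).step (hP _ h.mem) h.left_subset h.left_bot
    · exact (ihb w hw).step (hP _ h.mem) h.right_subset h.right_bot

theorem attached_mem (h : IsTower B v D n) :
    ∀ w ∈ insert v D, ∀ u ∈ B, IsAttachedOnTop w u → u ∈ D := by
  induction h with
  | leaf hv hn =>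
    rintro w (rfl | hw) u hu hwu
    exacts [(hn u hu hwu).elim, hw.elim]
  | fork h _ _ iha ihb =>
    rintro w (rfl | hw | hw) u hu hwu
    · rcases (h.attached u hu).1 hwu with rfl | rfl
      · exact Or.inl (Set.mem_insert _ _)
      · exact Or.inr (Set.mem_insert _ _)
    · exact Or.inl (Or.inr (iha w hw u hu hwu))
    · exact Or.inr (Or.inr (ihb w hw u hu hwu))

theorem exists_fork_below (h : IsTower B v D n) :
    ∀ w ∈ D, ∃ u ∈ insert v D, ∃ a b i j, IsFork B u a b i j ∧ (w = a ∨ w = b) := by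
  induction h with
  | leaf => exact fun w hw => hw.elim
  | @fork v a b i j D E m n h _ _ iha ihb =>
    rintro w ((rfl | hw) | (rfl | hw))
    · exact ⟨v, Or.inl rfl, w, b, i, j, h, Or.inl rfl⟩
    · obtain ⟨u, hu, h'⟩ := iha w hw
      exact ⟨u, Or.inr (Or.inl hu), h'⟩
    · exact ⟨v, Or.inl rfl, a, w, i, j, h, Or.inr rfl⟩
    · obtain ⟨u, hu, h'⟩ := ihb w hw
      exact ⟨u, Or.inr (Or.inr hu), h'⟩

/-! ### Counting reflex edges and placing guards -/

-- The bounds on height and projection strengthen the induction: they keep the edges of different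
-- forks distinct.
open Classical in
theorem exists_reflexEdges (hB : IsStacked B) (hfin : B.Finite) (h : IsTower B v D n) :
    ∃ S : Finset (Point × Point), S.card = 2 * n ∧
      ∀ e ∈ S, e ∈ reflexEdges (⋃ b ∈ B, b.carrier) ∧ v.hi 2 ≤ e.1 2 ∧
        ∀ k, k ≠ 2 → v.lo k ≤ e.1 k ∧ e.1 k ≤ v.hi k := by
  induction h with
  | leaf => exact ⟨∅, by simp⟩
  | @fork v a b i j D E m n h _ _ iha ihb =>
    obtain ⟨S, hS, hS'⟩ := iha
    obtain ⟨T, hT, hT'⟩ := ihb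
    have ha := a.lt
    have hb := b.lt
    have hgap := h.gap
    have hfst : ∀ t, (ridge v i j t).1 i = t := fun t => by simp [ridge, mkPoint_fst]
    have htwo : ∀ t, (ridge v i j t).1 2 = v.hi 2 := fun t => by simp [ridge, mkPoint_two h.ne_fst]
    -- The gap separates the projections of the two subtrees.
    have hST : Disjoint S T := by
      refine Finset.disjoint_left.2 fun e he he' => ?_
      have h1 := ((hS' e he).2.2 i h.ne_fst).2
      have h2 := ((hT' e he').2.2 i h.ne_fst).1
      linarith
    -- Edges of a subtree are no lower than the top of its root, hence strictly above the ridges of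
    -- `v`.
    have h1 : ∀ t, ridge v i j t ∉ S ∪ T := by
      intro t ht
      rcases Finset.mem_union.1 ht with ht | ht
      · have := (hS' _ ht).2.1
        rw [htwo] at this
        linarith [ha 2, h.left_bot]
      · have := (hT' _ ht).2.1
        rw [htwo] at this
        linarith [hb 2, h.right_bot]
    have h2 : ridge v i j (a.hi i) ≠ ridge v i j (b.lo i) := by
      intro he
      have := congrArg (fun e : Point × Point => e.1 i) he
      simp only [hfst] at this
      linarith
    refine ⟨insert (ridge v i j (a.hi i)) (insert (ridge v i j (b.lo i)) (S ∪ T)), ?_, ?_⟩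
    · rw [Finset.card_insert_of_notMem, Finset.card_insert_of_notMem (h1 _),
        Finset.card_union_of_disjoint hST, hS, hT]
      · ring
      · rw [Finset.mem_insert, not_or]
        exact ⟨h2, h1 _⟩
    · have hr : ∀ t, v.lo i ≤ t → t ≤ v.hi i → v.hi 2 ≤ (ridge v i j t).1 2 ∧
          ∀ k, k ≠ 2 → v.lo k ≤ (ridge v i j t).1 k ∧ (ridge v i j t).1 k ≤ v.hi k := by
        intro t ht1 ht2
        refine ⟨(htwo t).ge, fun k hk => ?_⟩
        rcases axis_cases h.ne h.ne_fst h.ne_snd k with rfl | rfl | rfl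
        · rw [hfst]; exact ⟨ht1, ht2⟩
        · simp only [ridge, mkPoint_snd h.ne h.ne_snd]
          exact ⟨le_rfl, (v.lt k).le⟩
        · exact (hk rfl).elim
      intro e he
      have hl := h.left_subset
      have hr' := h.right_subset
      simp only [Finset.mem_insert, Finset.mem_union] at he
      rcases he with rfl | rfl | he | he
      · exact ⟨h.left_reflex hB hfin, hr _ (by linarith [ha i, (hl i h.ne_fst).1])
          (hl i h.ne_fst).2⟩
      · exact ⟨h.right_reflex hB hfin, hr _ (hr' i h.ne_fst).1
          (by linarith [hb i, (hr' i h.ne_fst).2])⟩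
      · obtain ⟨e1, e2, e3⟩ := hS' e he
        exact ⟨e1, by linarith [ha 2, h.left_bot], fun k hk =>
          ⟨(hl k hk).1.trans (e3 k hk).1, (e3 k hk).2.trans (hl k hk).2⟩⟩
      · obtain ⟨e1, e2, e3⟩ := hT' e he
        exact ⟨e1, by linarith [hb 2, h.right_bot], fun k hk =>
          ⟨(hr' k hk).1.trans (e3 k hk).1, (e3 k hk).2.trans (hr' k hk).2⟩⟩

open Classical in
/-- If a side of `v` orthogonal to axis `i` is guarded, then `n` more guards suffice for the tower,
and one of them can be saved unless all bricks are equally wide along the other axis `j`. -/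
theorem exists_guards (hB : IsStacked B) (hfin : B.Finite) (h : IsTower B v D n)
    {i j : Fin 3} (hij : i ≠ j) (hi : i ≠ 2) (hj : j ≠ 2) {t : ℝ} (ht : t = v.lo i ∨ t = v.hi i) :
    ∃ G : Finset (Point × Point), (∀ e ∈ G, e ∈ reflexEdges (⋃ b ∈ B, b.carrier)) ∧ G.card ≤ n ∧
      (∀ w ∈ insert v D, (w.lo i ≤ t ∧ t ≤ w.hi i) ∨
        ∃ e ∈ G, Watches (⋃ b ∈ B, b.carrier) e w) ∧
      ((∀ w ∈ insert v D, w.lo j = v.lo j ∧ w.hi j = v.hi j) ∨ G.card + 1 ≤ n) := by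
  have hP : ∀ b ∈ B, b.carrier ⊆ ⋃ b ∈ B, b.carrier := fun b hb => Set.subset_biUnion_of_mem hb
  have hself : ∀ v : Box, (t = v.lo i ∨ t = v.hi i) → v.lo i ≤ t ∧ t ≤ v.hi i := by
    intro v ht
    have := v.lt i
    rcases ht with ht | ht <;> constructor <;> linarith
  induction h generalizing t with
  | @leaf v hv hn =>
    refine ⟨∅, by simp, by simp, ?_, Or.inl ?_⟩
    · rintro w (rfl | hw)
      exacts [Or.inl (hself _ ht), hw.elim]
    · rintro w (rfl | hw)
      exacts [⟨rfl, rfl⟩, hw.elim]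
  | @fork v a b i' j' D E m n h ha hb iha ihb =>
    by_cases hii : i' = i
    · subst hii
      obtain rfl : j' = j := by
        have := axis_cases h.ne h.ne_fst h.ne_snd j
        rcases this with h' | h' | h'
        exacts [(hij h'.symm).elim, h'.symm, (hj h').elim]
      have hsa := ha.standsOn hP
      have hsb := hb.standsOn hP
      -- The child at the guarded end keeps the coordinate `t`. The other child takes its inner side
      -- as guarded side, and its ridge `e` is the one new guard.
      obtain ⟨ta, tb, e, hta, htb, he, hae, hbe⟩ : ∃ ta tb e, (ta = a.lo i' ∨ ta = a.hi i') ∧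
          (tb = b.lo i' ∨ tb = b.hi i') ∧ e ∈ reflexEdges (⋃ b ∈ B, b.carrier) ∧
          (∀ w ∈ insert a D, (w.lo i' ≤ ta ∧ ta ≤ w.hi i') →
            (w.lo i' ≤ t ∧ t ≤ w.hi i') ∨ Watches (⋃ b ∈ B, b.carrier) e w) ∧
          (∀ w ∈ insert b E, (w.lo i' ≤ tb ∧ tb ≤ w.hi i') →
            (w.lo i' ≤ t ∧ t ≤ w.hi i') ∨ Watches (⋃ b ∈ B, b.carrier) e w) := by
        rcases ht with rfl | rfl
        · refine ⟨v.lo i', b.lo i', _, Or.inl h.left_lo.symm, Or.inl rfl, h.right_reflex hB hfin,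
            fun w _ hw => Or.inl hw, fun w hw hw' => Or.inr ?_⟩
          exact ridge_watches_of_standsOn hij hi hj hw' h.right_bot h.right_lo' h.right_hi'
            (hsb w hw)
        · refine ⟨a.hi i', v.hi i', _, Or.inr rfl, Or.inr h.right_hi.symm, h.left_reflex hB hfin,
            fun w hw hw' => Or.inr ?_, fun w _ hw => Or.inl hw⟩
          exact ridge_watches_of_standsOn hij hi hj hw' h.left_bot h.left_lo' h.left_hi' (hsa w hw)
      obtain ⟨G, hG, hGc, hGw, hGm⟩ := iha hta (fun v hv => by
        have := v.lt i'
        rcases hv with hv | hv <;> constructor <;> linarith)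
      obtain ⟨H, hH, hHc, hHw, hHm⟩ := ihb htb (fun v hv => by
        have := v.lt i'
        rcases hv with hv | hv <;> constructor <;> linarith)
      have hcard : (insert e (G ∪ H)).card ≤ G.card + H.card + 1 :=
        (Finset.card_insert_le _ _).trans (Nat.add_le_add_right (Finset.card_union_le _ _) 1)
      refine ⟨insert e (G ∪ H), ?_, by omega, ?_, ?_⟩
      · intro e' he'
        simp only [Finset.mem_insert, Finset.mem_union] at he'
        rcases he' with rfl | h' | h'
        exacts [he, hG _ h', hH _ h']
      · rintro w (rfl | hw | hw)
        · exact Or.inl (hself _ ht)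
        · rcases hGw w hw with hw' | ⟨e', he', hw'⟩
          · exact (hae w hw hw').imp_right fun h' => ⟨e, by simp, h'⟩
          · exact Or.inr ⟨e', by simp [he'], hw'⟩
        · rcases hHw w hw with hw' | ⟨e', he', hw'⟩
          · exact (hbe w hw hw').imp_right fun h' => ⟨e, by simp, h'⟩
          · exact Or.inr ⟨e', by simp [he'], hw'⟩
      · rcases hGm with hGm | hGm
        · rcases hHm with hHm | hHm
          · left
            rintro w (rfl | hw | hw)
            · exact ⟨rfl, rfl⟩
            · exact ⟨(hGm w hw).1.trans h.left_lo', (hGm w hw).2.trans h.left_hi'⟩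
            · exact ⟨(hHm w hw).1.trans h.right_lo', (hHm w hw).2.trans h.right_hi'⟩
          · right; omega
        · right; omega
    · obtain rfl : j' = i := by
        have := axis_cases h.ne h.ne_fst h.ne_snd i
        rcases this with h' | h' | h'
        exacts [(hii h'.symm).elim, h'.symm, (hi h').elim]
      -- A fork across the other axis: both children have the `i`-extent of `v`, so `t` is a side of
      -- each and this fork costs no guard.
      obtain ⟨G, hG, hGc, hGw, -⟩ := iha (t := t) (by rwa [h.left_lo', h.left_hi']) hself
      obtain ⟨H, hH, hHc, hHw, -⟩ := ihb (t := t) (by rwa [h.right_lo', h.right_hi']) hself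
      have hcard := Finset.card_union_le G H
      refine ⟨G ∪ H, ?_, by omega, ?_, Or.inr (by omega)⟩
      · intro e' he'
        rcases Finset.mem_union.1 he' with h' | h'
        exacts [hG _ h', hH _ h']
      · rintro w (rfl | hw | hw)
        · exact Or.inl (hself _ ht)
        · exact (hGw w hw).imp_right fun ⟨e', he', hw'⟩ => ⟨e', by simp [he'], hw'⟩
        · exact (hHw w hw).imp_right fun ⟨e', he', hw'⟩ => ⟨e', by simp [he'], hw'⟩

open Classical in
/-- A tower whose bricks do not all have the same extent along a horizontal axis is guarded by as
many edges as it has forks. -/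
theorem exists_guards_or_uniform (hB : IsStacked B) (hfin : B.Finite) (h : IsTower B v D n) :
    (∃ G : Finset (Point × Point), (∀ e ∈ G, e ∈ reflexEdges (⋃ b ∈ B, b.carrier)) ∧
      G.card ≤ n ∧ ∀ w ∈ insert v D, ∃ e ∈ G, Watches (⋃ b ∈ B, b.carrier) e w) ∨
    ∃ j : Fin 3, j ≠ 2 ∧ ∀ w ∈ insert v D, w.lo j = v.lo j ∧ w.hi j = v.hi j := by
  have hP : ∀ b ∈ B, b.carrier ⊆ ⋃ b ∈ B, b.carrier := fun b hb => Set.subset_biUnion_of_mem hb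
  cases h with
  | leaf hv hn =>
    refine Or.inr ⟨0, by decide, ?_⟩
    rintro w (rfl | hw)
    exacts [⟨rfl, rfl⟩, hw.elim]
  | @fork _ a b i j D E m n h ha hb =>
    obtain ⟨G, hG, hGc, hGw, hGm⟩ := ha.exists_guards hB hfin h.ne h.ne_fst h.ne_snd (Or.inr rfl)
    obtain ⟨H, hH, hHc, hHw, hHm⟩ := hb.exists_guards hB hfin h.ne h.ne_fst h.ne_snd (Or.inl rfl)
    -- If both subtrees are uniform along `j`, so is the whole tower. Otherwise one of them saves a
    -- guard, which pays for the second ridge at the root.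
    by_cases huni : (∀ w ∈ insert a D, w.lo j = a.lo j ∧ w.hi j = a.hi j) ∧
        ∀ w ∈ insert b E, w.lo j = b.lo j ∧ w.hi j = b.hi j
    · refine Or.inr ⟨j, h.ne_snd, ?_⟩
      rintro w (rfl | hw | hw)
      · exact ⟨rfl, rfl⟩
      · exact ⟨(huni.1 w hw).1.trans h.left_lo', (huni.1 w hw).2.trans h.left_hi'⟩
      · exact ⟨(huni.2 w hw).1.trans h.right_lo', (huni.2 w hw).2.trans h.right_hi'⟩
    have hGH : G.card + H.card + 1 ≤ m + n := by
      by_contra hlt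
      exact huni ⟨hGm.resolve_right (by omega), hHm.resolve_right (by omega)⟩
    have hwa : ∀ w ∈ insert a D, (w.lo i ≤ a.hi i ∧ a.hi i ≤ w.hi i) →
        Watches (⋃ b ∈ B, b.carrier) (ridge v i j (a.hi i)) w := fun w hw hw' =>
      ridge_watches_of_standsOn h.ne h.ne_fst h.ne_snd hw' h.left_bot h.left_lo' h.left_hi'
        (ha.standsOn hP w hw)
    have hwb : ∀ w ∈ insert b E, (w.lo i ≤ b.lo i ∧ b.lo i ≤ w.hi i) →
        Watches (⋃ b ∈ B, b.carrier) (ridge v i j (b.lo i)) w := fun w hw hw' =>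
      ridge_watches_of_standsOn h.ne h.ne_fst h.ne_snd hw' h.right_bot h.right_lo' h.right_hi'
        (hb.standsOn hP w hw)
    refine Or.inl ⟨insert (ridge v i j (a.hi i)) (insert (ridge v i j (b.lo i)) (G ∪ H)),
      ?_, ?_, ?_⟩
    · intro e he
      simp only [Finset.mem_insert, Finset.mem_union] at he
      rcases he with rfl | rfl | he | he
      exacts [h.left_reflex hB hfin, h.right_reflex hB hfin, hG _ he, hH _ he]
    · have h1 := Finset.card_insert_le (ridge v i j (a.hi i))
        (insert (ridge v i j (b.lo i)) (G ∪ H))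
      have h2 := Finset.card_insert_le (ridge v i j (b.lo i)) (G ∪ H)
      have h3 := Finset.card_union_le G H
      omega
    · rintro w (rfl | hw | hw)
      · refine ⟨_, Finset.mem_insert_self _ _, ridge_watches_base h.ne h.ne_fst h.ne_snd ?_
          (hP _ h.mem)⟩
        have := h.left_subset i h.ne_fst
        have := a.lt i
        constructor <;> linarith
      · rcases hGw w hw with hw' | ⟨e', he', hw'⟩
        · exact ⟨_, by simp, hwa w hw hw'⟩
        · exact ⟨e', by simp [he'], hw'⟩
      · rcases hHw w hw with hw' | ⟨e', he', hw'⟩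
        · exact ⟨_, by simp, hwb w hw hw'⟩
        · exact ⟨e', by simp [he'], hw'⟩

/-- No outside brick touches the tower: one on top of a tower brick would belong to it, one below
the root contradicts `hmin`, and one below another tower brick would be its unique parent, which is
in the tower. Two finite unions of closed boxes would then disconnect the castle. -/
theorem eq_of_isConnected (hB : IsStacked B) (hfin : B.Finite)
    (hf : ∀ v ∈ B, (∀ u ∈ B, ¬ IsAttachedOnTop v u) ∨ ∃ a b i j, IsFork B v a b i j)
    (hconn : IsConnected (⋃ b ∈ B, b.carrier)) (h : IsTower B v D n)
    (hmin : ∀ u ∈ B, v.lo 2 ≤ u.lo 2) : insert v D = B := by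
  have hsub : insert v D ⊆ B := Set.insert_subset h.mem h.subset
  refine hsub.antisymm fun u hu => by_contra fun huD => ?_
  have htouch : ∀ w ∈ insert v D, ∀ u ∈ B, u ∉ insert v D →
      ∀ p ∈ w.carrier, p ∉ u.carrier := by
    intro w hw u hu huD p hpw hpu
    have hne : w ≠ u := by rintro rfl; exact huD hw
    rcases hB w (hsub hw) u hu hne with h' | h' | h'
    · exact Set.disjoint_left.1 h' hpw hpu
    · exact huD (Or.inr (h.attached_mem w hw u hu ⟨h'.symm, p, hpw, hpu⟩))
    · rcases hw with rfl | hw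
      · have := hmin u hu
        have := u.lt 2
        linarith
      · obtain ⟨u', hu', a, b, i, j, hfork, hab⟩ := h.exists_fork_below w hw
        have := hfork.eq_of_attached hB hf hab hu ⟨h'.symm, p, hpu, hpw⟩
        exact huD (this ▸ hu')
  have hcl : ∀ S ⊆ B, IsClosed (⋃ b ∈ S, b.carrier) := fun S hS =>
    (hfin.subset hS).isClosed_biUnion fun b _ => b.isClosed_carrier
  obtain ⟨p, -, hp1, hp2⟩ := isPreconnected_closed_iff.1 hconn.isPreconnected
    (⋃ b ∈ insert v D, b.carrier) (⋃ b ∈ B \ insert v D, b.carrier) (hcl _ hsub)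
    (hcl _ Set.sdiff_subset) (by rw [← Set.biUnion_union, Set.union_sdiff_cancel hsub])
    ⟨v.lo, Set.mem_biUnion h.mem v.lo_mem, Set.mem_biUnion (Set.mem_insert _ _) v.lo_mem⟩
    ⟨u.lo, Set.mem_biUnion hu u.lo_mem, Set.mem_biUnion ⟨hu, huD⟩ u.lo_mem⟩
  simp only [Set.mem_iUnion, exists_prop] at hp1 hp2
  obtain ⟨w, hw, hpw⟩ := hp1
  obtain ⟨u', hu', hpu'⟩ := hp2
  exact htouch w hw u' hu'.1 hu'.2 p hpw hpu'

end IsTower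

/-! ### Prisms and the conclusion -/

theorem isPrism_of_uniform {B : Set Box} {v : Box} {j : Fin 3}
    (h : ∀ w ∈ B, w.lo j = v.lo j ∧ w.hi j = v.hi j) : IsPrism (⋃ b ∈ B, b.carrier) := by
  refine ⟨j, v.lo j, v.hi j, {q | ∃ w ∈ B, ∀ k : {k : Fin 3 // k ≠ j},
    w.lo k ≤ q k ∧ q k ≤ w.hi k}, v.lt j, ?_⟩
  ext p
  simp only [Set.mem_iUnion, exists_prop, Set.mem_ofPred_eq]
  constructor
  · rintro ⟨w, hw, hp⟩
    refine ⟨⟨w, hw, fun k => hp k⟩, ?_, ?_⟩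
    · rw [← (h w hw).1]; exact (hp j).1
    · rw [← (h w hw).2]; exact (hp j).2
  · rintro ⟨⟨w, hw, hp⟩, h1, h2⟩
    refine ⟨w, hw, fun k => ?_⟩
    by_cases hk : k = j
    · subst hk
      rw [(h w hw).1, (h w hw).2]
      exact ⟨h1, h2⟩
    · exact hp ⟨k, hk⟩

theorem GuardableByOpen.closed {P : Set Point} {n : ℕ} (h : GuardableByOpen P n) :
    GuardableByClosed P n := by
  obtain ⟨G, h1, h2, h3⟩ := h
  refine ⟨G, h1, h2, fun p hp => ?_⟩
  obtain ⟨e, he, x, hx, hs⟩ := h3 p hp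
  exact ⟨e, he, x, openSegment_subset_segment ℝ _ _ hx, hs⟩

end OrthoPoly

theorem lemmal4 (C : Set OrthoPoly.Point) (r : ℕ) (hC : OrthoPoly.IsCastle C)
    (hr : (OrthoPoly.reflexEdges C).encard = ((2 * r : ℕ) : ℕ∞))
    (hprism : ¬ OrthoPoly.IsPrism C) :
    OrthoPoly.GuardableByOpen C r ∧ OrthoPoly.GuardableByClosed C r := by
  suffices h : GuardableByOpen C r from ⟨h, h.closed⟩
  obtain ⟨B, ⟨⟨⟨hconn, -, -⟩, -⟩, ⟨hfin, rfl, hB, -⟩, hprim⟩, hdeg⟩ := hC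
  have hf : ∀ v ∈ B, (∀ u ∈ B, ¬ IsAttachedOnTop v u) ∨ ∃ a b i j, IsFork B v a b i j := by
    intro v hv
    rcases hdeg v hv with h | h
    · left
      intro u hu hvu
      rw [Set.encard_eq_zero] at h
      exact (Set.ext_iff.1 h u).1 ⟨hu, hvu⟩
    · exact Or.inr (exists_isFork hB hv (hprim v hv) h)
  have hne : B.Nonempty := by
    obtain ⟨p, hp⟩ := hconn.nonempty
    obtain ⟨b, hb, -⟩ := Set.mem_iUnion₂.1 hp
    exact ⟨b, hb⟩
  obtain ⟨v, hv, hmin⟩ := Set.exists_min_image B (fun b => b.lo 2) hfin hne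
  obtain ⟨D, n, hT⟩ := exists_isTower hfin hf v hv
  have hall := hT.eq_of_isConnected hB hfin hf hconn hmin
  obtain ⟨S, hS, hS'⟩ := hT.exists_reflexEdges hB hfin
  have hnr : n ≤ r := by
    have h1 := Set.encard_le_encard (fun e he => (hS' e he).1 :
      (S : Set (Point × Point)) ⊆ reflexEdges (⋃ b ∈ B, b.carrier))
    rw [hr, Set.encard_coe_eq_coe_finsetCard, hS, Nat.cast_le] at h1
    omega
  rcases hT.exists_guards_or_uniform hB hfin with ⟨G, hG, hGc, hGw⟩ | ⟨j, -, hj⟩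
  · refine ⟨G, hG, hGc.trans hnr, fun p hp => ?_⟩
    obtain ⟨w, hw, hpw⟩ := Set.mem_iUnion₂.1 hp
    obtain ⟨e, he, hew⟩ := hGw w (hall ▸ hw)
    exact ⟨e, he, hew p hpw⟩
  · rw [hall] at hj
    exact (hprism (isPrism_of_uniform hj)).elim
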